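/- Let $G$ be a (finite-dimensional, real, smooth) Lie group and let $H\subset G$ be a connected Lie subgroup, i.e. a connected Lie group injectively immersed in $G$ by a group homomorphism $\iota$, such that the space $G/H$ of left cosets is a smooth manifold for which the canonical projection $\pi:G\rightarrow G/H$ is a smooth submersion. Let $\mathfrak{V}$ be a smooth $k$-vector field on $G$, i.e. a smooth antisymmetric $k$-contravariant tensor field. Then $\mathfrak{V}$ can be projected onto $G/H$, i.e. there is a smooth $k$-vector field $\mathfrak{W}$ on $G/H$ with $\pi_{*g}\mathfrak{V}_g=\mathfrak{W}_{\pi(g)}$ for all $g\in G$, if and only if, for every left-invariant vector field $X^L$ on $G$ that is tangent to $H$, $$ \pi_{*g}\big((\mathcal{L}_{X^L}\mathfrak{V})_g\big)=0\qquad\text{for all } g\in G, $$ where $\mathcal{L}_{X^L}$ denotes the Lie derivative along $X^L$. -/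

import Mathlib

open scoped Manifold ContDiff

noncomputable section

/-- The `k`-vectors of a finite-dimensional real vector space `V`: antisymmetric `k`-contravariant
tensors, i.e. alternating `k`-linear forms on the dual space of `V`. -/
abbrev KVector (k : ℕ) (V : Type*) [AddCommGroup V] [Module ℝ V] [TopologicalSpace V] : Type _ :=
  (V →L[ℝ] ℝ) [⋀^Fin k]→L[ℝ] ℝ

/-- The push-forward of a `k`-vector under a linear map `A : V → W`:
`(A_* T)(α₁, …, α_k) = T(α₁ ∘ A, …, α_k ∘ A)`. -/
def KVector.map {k : ℕ} {V W : Type*} [AddCommGroup V] [Module ℝ V] [TopologicalSpace V]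
    [IsTopologicalAddGroup V] [ContinuousSMul ℝ V] [AddCommGroup W] [Module ℝ W]
    [TopologicalSpace W] [IsTopologicalAddGroup W] [ContinuousSMul ℝ W]
    (A : V →L[ℝ] W) (T : KVector k V) : KVector k W :=
  T.compContinuousLinearMap (ContinuousLinearMap.precomp ℝ A)

/-- The Lie derivative `ℒ_X T` of a `k`-vector field `T` along a vector field `X` on a normed
space:
`(ℒ_X T)_x(α₁, …, α_k) = (D_{X(x)} T)(α₁, …, α_k) - ∑ i, T_x(α₁, …, α_i ∘ DX(x), …, α_k)`.
The sum is the derivative of `L ↦ T_x(L α₁, …, L α_k)` at `L = id` in the direction of the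
transpose `α ↦ α ∘ DX(x)` of `DX(x)`. -/
def kvectorLieDeriv {k : ℕ} {E : Type*} [NormedAddCommGroup E] [NormedSpace ℝ E]
    (X : E → E) (T : E → KVector k E) (x : E) : KVector k E :=
  fderiv ℝ T x (X x) -
    (T x).fderivCompContinuousLinearMap (ContinuousLinearMap.id ℝ (E →L[ℝ] ℝ))
      (ContinuousLinearMap.precomp ℝ (fderiv ℝ X x))

section Manifold

variable {E : Type*} [NormedAddCommGroup E] [NormedSpace ℝ E]
  {M : Type*} [TopologicalSpace M] [ChartedSpace E M]

/-- The expression of a vector field on `M` in the preferred chart at `x₀`,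
as a function on `M`. -/
def vectorFieldInChart (x₀ : M) (X : Π x : M, TangentSpace 𝓘(ℝ, E) x) (x : M) : E :=
  mfderiv 𝓘(ℝ, E) 𝓘(ℝ, E) (extChartAt 𝓘(ℝ, E) x₀) x (X x)

/-- The expression of a `k`-vector field on `M` in the preferred chart at `x₀`,
as a function on `M`. -/
def kvectorFieldInChart {k : ℕ} (x₀ : M) (T : Π x : M, KVector k (TangentSpace 𝓘(ℝ, E) x))
    (x : M) : KVector k E :=
  KVector.map (mfderiv 𝓘(ℝ, E) 𝓘(ℝ, E) (extChartAt 𝓘(ℝ, E) x₀) x) (T x)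

/-- A `k`-vector field is smooth if its expression in charts is smooth. -/
def IsSmoothKVectorField {k : ℕ} (T : Π x : M, KVector k (TangentSpace 𝓘(ℝ, E) x)) : Prop :=
  ∀ x₀ : M, ContMDiffAt 𝓘(ℝ, E) 𝓘(ℝ, KVector k E) ∞ (kvectorFieldInChart x₀ T) x₀

/-- The Lie derivative `ℒ_X T` of a `k`-vector field `T` along a vector field `X` on a manifold,
computed at `x₀` in the preferred chart at `x₀`. -/
def mkvectorLieDeriv {k : ℕ} (X : Π x : M, TangentSpace 𝓘(ℝ, E) x)
    (T : Π x : M, KVector k (TangentSpace 𝓘(ℝ, E) x)) (x₀ : M) :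
    KVector k (TangentSpace 𝓘(ℝ, E) x₀) :=
  KVector.map (mfderiv 𝓘(ℝ, E) 𝓘(ℝ, E) (extChartAt 𝓘(ℝ, E) x₀) x₀).inverse
    (kvectorLieDeriv (E := E)
      (vectorFieldInChart x₀ X ∘ (extChartAt 𝓘(ℝ, E) x₀).symm)
      (kvectorFieldInChart x₀ T ∘ (extChartAt 𝓘(ℝ, E) x₀).symm)
      (extChartAt 𝓘(ℝ, E) x₀ x₀))

/-- A `k`-vector field `T` on `M` projects along `π : M → N` if there is a smooth `k`-vector field
`S` on `N` which is `π`-related to `T`, i.e. `π_{*x} T_x = S_{π(x)}` for all `x`. -/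
def Projects (F : Type*) [NormedAddCommGroup F] [NormedSpace ℝ F]
    {N : Type*} [TopologicalSpace N] [ChartedSpace F N] {k : ℕ} (π : M → N)
    (T : Π x : M, KVector k (TangentSpace 𝓘(ℝ, E) x)) : Prop :=
  ∃ S : Π y : N, KVector k (TangentSpace 𝓘(ℝ, F) y),
    IsSmoothKVectorField S ∧
      ∀ x : M, KVector.map (mfderiv 𝓘(ℝ, E) 𝓘(ℝ, F) π x) (T x) = S (π x)

/-- A vector field `X` on a Lie group is left-invariant if `(L_a)_* X_g = X_{a g}`, where `L_a` is
the left multiplication by `a`. -/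
def IsLeftInvariantVectorField [Group M] (X : Π g : M, TangentSpace 𝓘(ℝ, E) g) : Prop :=
  ∀ a g : M, mfderiv 𝓘(ℝ, E) 𝓘(ℝ, E) (fun b : M => a * b) g (X g) = X (a * g)

/-- A vector field `X` on `M` is tangent to the immersed submanifold `ι : P → M` if its value at
each point of it lies in the tangent space of the submanifold. -/
def IsTangentTo (F : Type*) [NormedAddCommGroup F] [NormedSpace ℝ F]
    {P : Type*} [TopologicalSpace P] [ChartedSpace F P] (ι : P → M)
    (X : Π x : M, TangentSpace 𝓘(ℝ, E) x) : Prop :=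
  ∀ p : P, ∃ w : TangentSpace 𝓘(ℝ, F) p, mfderiv 𝓘(ℝ, F) 𝓘(ℝ, E) ι p w = X (ι p)

end Manifold

end

/-! Fix a chart of `G ⧸ ι.range` and let `Ψ` be the function on `G` whose value at `x` is the
push-forward of `V x` under the projection `π`, read in that chart. `Ψ` takes values in a fixed
vector space, so it can be differentiated along a field `X`. The key identity is `dΨ(X) = π_*(ℒ_X
V)` whenever `dπ(X) = 0`. Indeed, let `P` be `π` in charts. Differentiating `(DP)_* V` along `X`
gives `(DP)_*(D_X V)` plus a term in `D²P(X, ·)`. Differentiating `DP(X) = 0` and using the symmetry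
of `D²P` gives `D²P(X, ·) = -DP ∘ DX`, which is exactly the correction term of the Lie derivative
(`fderiv_map_fderiv_apply_eq_map_kvectorLieDeriv`, `mfderiv_pushforwardInChart_apply`).

A left-invariant field tangent to `H` is tangent to every left coset, hence killed by `dπ`. If `V`
projects, `Ψ` factors through `π` and its derivative along such a field vanishes. Conversely, these
fields realize every tangent vector of every coset, so `p ↦ Ψ (g * ι p)` has zero derivative and is
constant because `H` is connected. The push-forward thus depends only on the coset, and local
sections of `π` make the resulting field smooth. -/

/-! ### Push-forward of `k`-vectors on normed spaces and its derivative. -/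

section KVector

variable {k : ℕ} {E F G : Type*} [NormedAddCommGroup E] [NormedSpace ℝ E]
  [NormedAddCommGroup F] [NormedSpace ℝ F] [NormedAddCommGroup G] [NormedSpace ℝ G]

/-- Antisymmetrization as a continuous linear map on continuous multilinear maps. -/
noncomputable def ContinuousMultilinearMap.alternatizationCLM (k : ℕ) (E F : Type*)
    [NormedAddCommGroup E] [NormedSpace ℝ E] [NormedAddCommGroup F] [NormedSpace ℝ F] :
    ContinuousMultilinearMap ℝ (fun _ : Fin k => E) F →L[ℝ] E [⋀^Fin k]→L[ℝ] F :=
  LinearMap.mkContinuous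
    { toFun := fun f => ContinuousMultilinearMap.alternatization f
      map_add' := map_add _
      map_smul' := fun c f => by
        ext v
        simp [ContinuousMultilinearMap.alternatization_apply_apply, Finset.smul_sum,
          smul_comm c] }
    -- Each of the `k!` summands is bounded by `‖f‖ * ∏ ‖v i‖`, since permuting the arguments only
    -- permutes the factors.
    (Fintype.card (Equiv.Perm (Fin k))) <| fun f => by
      refine ContinuousAlternatingMap.opNorm_le_bound _ (by positivity) fun v => ?_
      simp only [LinearMap.coe_mk, AddHom.coe_mk,
        ContinuousMultilinearMap.alternatization_apply_apply]
      refine (norm_sum_le _ _).trans ?_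
      rw [mul_assoc, ← nsmul_eq_mul]
      refine Finset.sum_le_card_nsmul _ _ _ fun σ _ => ?_
      have h1 : ‖Equiv.Perm.sign σ • f (v ∘ σ)‖ = ‖f (v ∘ σ)‖ := by
        rcases Int.units_eq_one_or (Equiv.Perm.sign σ) with h | h <;> simp [h]
      rw [h1]
      refine (f.le_opNorm _).trans_eq ?_
      congr 1
      exact Equiv.prod_comp σ fun i => ‖v i‖

theorem ContinuousMultilinearMap.alternatizationCLM_toContinuousMultilinearMap
    (f : E [⋀^Fin k]→L[ℝ] F) :
    alternatizationCLM k E F f.toContinuousMultilinearMap = (k.factorial : ℝ) • f := by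
  ext v
  change ContinuousMultilinearMap.alternatization f.toContinuousMultilinearMap v = _
  have h := congrArg (fun g => g v) (AlternatingMap.coe_alternatization f.toAlternatingMap)
  rw [← ContinuousAlternatingMap.coe_toAlternatingMap,
    ContinuousMultilinearMap.alternatization_apply_toAlternatingMap]
  refine Eq.trans h ?_
  simp [Nat.cast_smul_eq_nsmul]

/-- Composition of multilinear maps is multilinear in the inner linear maps, hence smooth. The
alternating case follows by applying `1 / k!` times antisymmetrization, which is continuous linear
and fixes alternating maps. -/
theorem ContinuousAlternatingMap.contDiff_compContinuousLinearMap {n : WithTop ℕ∞} :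
    ContDiff ℝ n (fun p : (F [⋀^Fin k]→L[ℝ] G) × (E →L[ℝ] F) =>
      p.1.compContinuousLinearMap p.2) := by
  have h1 : ContDiff ℝ n (fun p : (F [⋀^Fin k]→L[ℝ] G) × (E →L[ℝ] F) =>
      p.1.toContinuousMultilinearMap.compContinuousLinearMap fun _ : Fin k => p.2) := by
    have h2 := (ContinuousMultilinearMap.compContinuousLinearMapContinuousMultilinear ℝ
      (fun _ : Fin k => E) (fun _ : Fin k => F) G).contDiff (n := n)
    have h3 : ContDiff ℝ n (fun p : (F [⋀^Fin k]→L[ℝ] G) × (E →L[ℝ] F) =>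
        fun _ : Fin k => p.2) := contDiff_pi.2 fun _ => contDiff_snd
    let L : (F [⋀^Fin k]→L[ℝ] G) →L[ℝ] ContinuousMultilinearMap ℝ (fun _ : Fin k => F) G :=
      ContinuousAlternatingMap.toContinuousMultilinearMapCLM ℝ
    exact (h2.comp h3).clm_apply (L.contDiff.comp contDiff_fst)
  have h2 := ((ContinuousMultilinearMap.alternatizationCLM k E G).contDiff (n := n)).comp h1
  have h3 : (fun p : (F [⋀^Fin k]→L[ℝ] G) × (E →L[ℝ] F) => p.1.compContinuousLinearMap p.2) =
      fun p => (k.factorial : ℝ)⁻¹ • ContinuousMultilinearMap.alternatizationCLM k E G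
        (p.1.toContinuousMultilinearMap.compContinuousLinearMap fun _ : Fin k => p.2) := by
    funext p
    have h := ContinuousMultilinearMap.alternatizationCLM_toContinuousMultilinearMap
      (p.1.compContinuousLinearMap p.2)
    rw [eq_inv_smul_iff₀ (by positivity), ← h]
    rfl
  rw [h3]
  exact h2.const_smul _

namespace KVector

theorem map_apply (A : E →L[ℝ] F) (T : KVector k E) (α : Fin k → F →L[ℝ] ℝ) :
    map A T α = T fun i => (α i).comp A := rfl

theorem map_id (T : KVector k E) : map (ContinuousLinearMap.id ℝ E) T = T := rfl

theorem contDiffAt_map {n : WithTop ℕ∞} {A : G → E →L[ℝ] F} {T : G → KVector k E} {x : G}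
    (hA : ContDiffAt ℝ n A x) (hT : ContDiffAt ℝ n T x) :
    ContDiffAt ℝ n (fun y => map (A y) (T y)) x := by
  have h : ContDiffAt ℝ n (fun y => (ContinuousLinearMap.compL ℝ E F ℝ).flip (A y)) x :=
    hA.continuousLinearMap_comp _
  exact (ContinuousAlternatingMap.contDiff_compContinuousLinearMap.contDiffAt).comp x
    (hT.prodMk h)

/-- The derivative of `y ↦ (A_y)_* T_y` in the direction `v`. -/
theorem fderiv_map_apply {A : G → E →L[ℝ] F} {T : G → KVector k E} {x : G}
    (hA : DifferentiableAt ℝ A x) (hT : DifferentiableAt ℝ T x) (v : G) :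
    fderiv ℝ (fun y => map (A y) (T y)) x v =
      map (A x) (fderiv ℝ T x v) +
        (T x).fderivCompContinuousLinearMap (ContinuousLinearMap.precomp ℝ (A x))
          (ContinuousLinearMap.precomp ℝ (fderiv ℝ A x v)) := by
  have h : HasFDerivAt (fun y => (ContinuousLinearMap.compL ℝ E F ℝ).flip (A y))
      ((ContinuousLinearMap.compL ℝ E F ℝ).flip.comp (fderiv ℝ A x)) x :=
    HasFDerivAt.comp x (g := fun B => (ContinuousLinearMap.compL ℝ E F ℝ).flip B)
      (ContinuousLinearMap.hasFDerivAt _) hA.hasFDerivAt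
  have h2 := (hT.hasFDerivAt.continuousAlternatingMapCompContinuousLinearMap h).fderiv
  exact congrArg (fun L => L v) h2

end KVector

/-- If the vector field `X` is annihilated by the differential of `P`, the derivative along `X` of
the push-forward of a `k`-vector field along `P` is the push-forward of its Lie derivative. -/
theorem fderiv_map_fderiv_apply_eq_map_kvectorLieDeriv {P : E → F} {X : E → E}
    {T : E → KVector k E} {x : E} (hP : ContDiffAt ℝ 2 P x) (hX : DifferentiableAt ℝ X x)
    (hT : DifferentiableAt ℝ T x) (hPX : ∀ᶠ y in nhds x, fderiv ℝ P y (X y) = 0) :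
    fderiv ℝ (fun y => KVector.map (fderiv ℝ P y) (T y)) x (X x) =
      KVector.map (fderiv ℝ P x) (kvectorLieDeriv X T x) := by
  have hP' : DifferentiableAt ℝ (fderiv ℝ P) x :=
    (hP.fderiv_right (m := 1) (by norm_num)).differentiableAt (by norm_num)
  have hsymm : IsSymmSndFDerivAt ℝ P x := hP.isSymmSndFDerivAt (by simp)
  -- Differentiating `DP(X) = 0` in the direction `v` gives `D²P(v, X) + DP(DX v) = 0`; symmetry of
  -- `D²P` moves `X` to the first slot.
  have hD : fderiv ℝ (fderiv ℝ P) x (X x) = -(fderiv ℝ P x).comp (fderiv ℝ X x) := by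
    have h0 : fderiv ℝ (fun y => fderiv ℝ P y (X y)) x = 0 := by
      have : (fun y => fderiv ℝ P y (X y)) =ᶠ[nhds x] fun _ => 0 := hPX
      rw [this.fderiv_eq]; simp
    rw [fderiv_clm_apply hP' hX] at h0
    ext v
    have h1 := congrArg (fun L => L v) h0
    simp only [add_apply, ContinuousLinearMap.comp_apply,
      ContinuousLinearMap.flip_apply, zero_apply] at h1
    rw [hsymm.eq]
    simpa using eq_neg_of_add_eq_zero_right h1
  rw [KVector.fderiv_map_apply hP' hT, hD]
  ext α
  simp only [KVector.map_apply, kvectorLieDeriv, ContinuousAlternatingMap.add_apply,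
    ContinuousAlternatingMap.sub_apply, ContinuousAlternatingMap.fderivCompContinuousLinearMap_apply]
  rw [sub_eq_add_neg, ← Finset.sum_neg_distrib]
  congr 1
  refine Finset.sum_congr rfl fun i _ => ?_
  -- The sign from `hD` sits in the `i`-th slot and comes out by linearity, matching the subtracted
  -- term of the Lie derivative.
  have e : ∀ β : E →L[ℝ] ℝ, (T x) (Function.update (fun j => (α j).comp (fderiv ℝ P x)) i (-β)) =
      -(T x) (Function.update (fun j => (α j).comp (fderiv ℝ P x)) i β) := fun β =>
    (T x).toMultilinearMap.map_update_neg _ i β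
  trans (T x) (Function.update (fun j => (α j).comp (fderiv ℝ P x)) i
    (-((α i).comp (fderiv ℝ P x)).comp (fderiv ℝ X x)))
  · congr 1
    funext j
    rcases eq_or_ne j i with rfl | h
    · ext; simp
    · simp [h]
  · rw [e]
    congr 2
    funext j
    rcases eq_or_ne j i with rfl | h
    · ext; simp
    · simp [h]

end KVector

/-! ### Push-forward of a `k`-vector field along a smooth map, in charts. -/

section PushforwardInChart

variable {k : ℕ} {E : Type*} [NormedAddCommGroup E] [NormedSpace ℝ E]
  {M : Type*} [TopologicalSpace M] [ChartedSpace E M]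
  {F : Type*} [NormedAddCommGroup F] [NormedSpace ℝ F]
  {N : Type*} [TopologicalSpace N] [ChartedSpace F N]

/-- The push-forward along `f : M → N` of the value of a `k`-vector field at `x`, expressed in the
preferred chart at `y₀`. -/
noncomputable def pushforwardInChart (y₀ : N) (f : M → N)
    (T : Π x : M, KVector k (TangentSpace 𝓘(ℝ, E) x)) (x : M) : KVector k F :=
  KVector.map (mfderiv 𝓘(ℝ, F) 𝓘(ℝ, F) (extChartAt 𝓘(ℝ, F) y₀) (f x))
    (KVector.map (mfderiv 𝓘(ℝ, E) 𝓘(ℝ, F) f x) (T x))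

/-- The expression of `f : M → N` in the preferred charts at `x₀` and `f x₀`. -/
noncomputable def writtenInPreferredCharts (E F : Type*) [NormedAddCommGroup E] [NormedSpace ℝ E]
    [NormedAddCommGroup F] [NormedSpace ℝ F] {M N : Type*} [TopologicalSpace M] [ChartedSpace E M]
    [TopologicalSpace N] [ChartedSpace F N] (f : M → N) (x₀ : M) : E → F :=
  extChartAt 𝓘(ℝ, F) (f x₀) ∘ f ∘ (extChartAt 𝓘(ℝ, E) x₀).symm

theorem extChartAt_target_mem_nhds_self (x₀ : M) :
    (extChartAt 𝓘(ℝ, E) x₀).target ∈ nhds (extChartAt 𝓘(ℝ, E) x₀ x₀) :=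
  extChartAt_target_mem_nhds x₀

theorem contDiffAt_writtenInPreferredCharts {n : WithTop ℕ∞} {f : M → N} {x₀ : M}
    (hf : ContMDiffAt 𝓘(ℝ, E) 𝓘(ℝ, F) n f x₀) :
    ContDiffAt ℝ n (writtenInPreferredCharts E F f x₀) (extChartAt 𝓘(ℝ, E) x₀ x₀) := by
  have h := (contMDiffAt_iff.1 hf).2
  rwa [modelWithCornersSelf_coe, Set.range_id, contDiffWithinAt_univ] at h

theorem contDiffAt_comp_extChartAt_symm {n : WithTop ℕ∞} {f : M → F} {x₀ : M}
    (hf : ContMDiffAt 𝓘(ℝ, E) 𝓘(ℝ, F) n f x₀) :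
    ContDiffAt ℝ n (f ∘ (extChartAt 𝓘(ℝ, E) x₀).symm) (extChartAt 𝓘(ℝ, E) x₀ x₀) :=
  contDiffAt_writtenInPreferredCharts hf

theorem mfderiv_eq_fderiv_writtenInPreferredCharts {f : M → N} {x₀ : M}
    (hf : MDifferentiableAt 𝓘(ℝ, E) 𝓘(ℝ, F) f x₀) :
    mfderiv 𝓘(ℝ, E) 𝓘(ℝ, F) f x₀ =
      fderiv ℝ (writtenInPreferredCharts E F f x₀) (extChartAt 𝓘(ℝ, E) x₀ x₀) := by
  rw [hf.mfderiv, modelWithCornersSelf_coe, Set.range_id, fderivWithin_univ]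
  rfl

theorem contDiffAt_map_fderiv_writtenInPreferredCharts {f : M → N} (x₀ : M)
    (hf : ContMDiff 𝓘(ℝ, E) 𝓘(ℝ, F) ∞ f) {T : Π x : M, KVector k (TangentSpace 𝓘(ℝ, E) x)}
    (hT : IsSmoothKVectorField T) :
    ContDiffAt ℝ ∞ (fun y => KVector.map (fderiv ℝ (writtenInPreferredCharts E F f x₀) y)
        ((kvectorFieldInChart x₀ T ∘ (extChartAt 𝓘(ℝ, E) x₀).symm) y))
      (extChartAt 𝓘(ℝ, E) x₀ x₀) :=
  KVector.contDiffAt_map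
    ((contDiffAt_writtenInPreferredCharts hf.contMDiffAt).fderiv_right (by simp))
    (contDiffAt_comp_extChartAt_symm (hT x₀))

variable [IsManifold 𝓘(ℝ, E) ∞ M] [IsManifold 𝓘(ℝ, F) ∞ N]

/-- The chain rule for a smooth map written in charts, at points near the base point. -/
theorem eventually_mfderiv_extChartAt_comp_mfderiv {f : M → N} (x₀ : M)
    (hf : ContMDiff 𝓘(ℝ, E) 𝓘(ℝ, F) ∞ f) :
    ∀ᶠ x in nhds x₀,
      (mfderiv 𝓘(ℝ, F) 𝓘(ℝ, F) (extChartAt 𝓘(ℝ, F) (f x₀)) (f x) : F →L[ℝ] F).comp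
        (mfderiv 𝓘(ℝ, E) 𝓘(ℝ, F) f x : E →L[ℝ] F) =
      (fderiv ℝ (writtenInPreferredCharts E F f x₀) (extChartAt 𝓘(ℝ, E) x₀ x)).comp
        (mfderiv 𝓘(ℝ, E) 𝓘(ℝ, E) (extChartAt 𝓘(ℝ, E) x₀) x : E →L[ℝ] E) := by
  have : IsManifold 𝓘(ℝ, E) 1 M := .of_le (n := ∞) (by simp)
  have : IsManifold 𝓘(ℝ, F) 1 N := .of_le (n := ∞) (by simp)
  have hsrc : ∀ᶠ x in nhds x₀, x ∈ (chartAt E x₀).source :=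
    (chartAt E x₀).open_source.mem_nhds (mem_chart_source E x₀)
  have hsrc' : ∀ᶠ x in nhds x₀, f x ∈ (chartAt F (f x₀)).source :=
    hf.continuous.continuousAt.preimage_mem_nhds
      ((chartAt F (f x₀)).open_source.mem_nhds (mem_chart_source F (f x₀)))
  have hP : ∀ᶠ x in nhds x₀,
      DifferentiableAt ℝ (writtenInPreferredCharts E F f x₀) (extChartAt 𝓘(ℝ, E) x₀ x) := by
    have h1 : ContDiffAt ℝ 1 (writtenInPreferredCharts E F f x₀) (extChartAt 𝓘(ℝ, E) x₀ x₀) :=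
      (contDiffAt_writtenInPreferredCharts hf.contMDiffAt).of_le (by simp)
    have h2 := (h1.eventually (by simp)).mono fun y hy => hy.differentiableAt (by simp)
    exact (continuousAt_extChartAt x₀).eventually h2
  -- `e3` compares germs at `x`, so a whole neighbourhood of `x` must lie in the chart source.
  filter_upwards [hsrc.eventually_nhds, hsrc', hP] with x hx hx' hPx
  have hx0 := hx.self_of_nhds
  have d1 : MDifferentiableAt 𝓘(ℝ, F) 𝓘(ℝ, F) (extChartAt 𝓘(ℝ, F) (f x₀)) (f x) :=
    mdifferentiableAt_extChartAt hx'
  have d2 : MDifferentiableAt 𝓘(ℝ, E) 𝓘(ℝ, F) f x := hf.mdifferentiableAt (by simp)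
  have d3 : MDifferentiableAt 𝓘(ℝ, E) 𝓘(ℝ, E) (extChartAt 𝓘(ℝ, E) x₀) x :=
    mdifferentiableAt_extChartAt hx0
  have e1 := mfderiv_comp x d1 d2
  have e2 := mfderiv_comp x hPx.mdifferentiableAt d3
  have e3 : extChartAt 𝓘(ℝ, F) (f x₀) ∘ f =ᶠ[nhds x]
      writtenInPreferredCharts E F f x₀ ∘ extChartAt 𝓘(ℝ, E) x₀ := by
    filter_upwards [hx] with z hz
    simp only [writtenInPreferredCharts, Function.comp_apply]
    rw [(extChartAt 𝓘(ℝ, E) x₀).left_inv (by rwa [extChartAt_source])]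
  rw [e3.mfderiv_eq, e2, mfderiv_eq_fderiv] at e1
  exact e1.symm

theorem pushforwardInChart_eventuallyEq {f : M → N} (x₀ : M)
    (hf : ContMDiff 𝓘(ℝ, E) 𝓘(ℝ, F) ∞ f) (T : Π x : M, KVector k (TangentSpace 𝓘(ℝ, E) x)) :
    pushforwardInChart (f x₀) f T =ᶠ[nhds x₀]
      (fun y => KVector.map (fderiv ℝ (writtenInPreferredCharts E F f x₀) y)
        ((kvectorFieldInChart x₀ T ∘ (extChartAt 𝓘(ℝ, E) x₀).symm) y)) ∘
          extChartAt 𝓘(ℝ, E) x₀ := by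
  have hsrc : ∀ᶠ x in nhds x₀, x ∈ (chartAt E x₀).source :=
    (chartAt E x₀).open_source.mem_nhds (mem_chart_source E x₀)
  filter_upwards [hsrc, eventually_mfderiv_extChartAt_comp_mfderiv x₀ hf] with x hx h
  simp only [Function.comp_apply]
  rw [(extChartAt 𝓘(ℝ, E) x₀).left_inv (by rwa [extChartAt_source])]
  exact congrArg (fun A : E →L[ℝ] F => KVector.map A (T x : KVector k E)) h

theorem contMDiffAt_pushforwardInChart {f : M → N} (x₀ : M)
    (hf : ContMDiff 𝓘(ℝ, E) 𝓘(ℝ, F) ∞ f) {T : Π x : M, KVector k (TangentSpace 𝓘(ℝ, E) x)}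
    (hT : IsSmoothKVectorField T) :
    ContMDiffAt 𝓘(ℝ, E) 𝓘(ℝ, KVector k F) ∞ (pushforwardInChart (F := F) (f x₀) f T) x₀ :=
  ((contDiffAt_map_fderiv_writtenInPreferredCharts (F := F) x₀ hf hT).contMDiffAt.comp x₀
    contMDiffAt_extChartAt).congr_of_eventuallyEq (pushforwardInChart_eventuallyEq (F := F) x₀ hf T)

/-- On the chart source, the trivialization of the tangent bundle at `x₀` is the differential of the
preferred chart. -/
theorem differentiableAt_vectorFieldInChart_comp_extChartAt_symm
    {X : Π x : M, TangentSpace 𝓘(ℝ, E) x} {x₀ : M}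
    (hX : MDifferentiableAt 𝓘(ℝ, E) 𝓘(ℝ, E).tangent
      (fun x => (⟨x, X x⟩ : TangentBundle 𝓘(ℝ, E) M)) x₀) :
    DifferentiableAt ℝ (vectorFieldInChart x₀ X ∘ (extChartAt 𝓘(ℝ, E) x₀).symm)
      (extChartAt 𝓘(ℝ, E) x₀ x₀) := by
  have : IsManifold 𝓘(ℝ, E) 1 M := .of_le (n := ∞) (by simp)
  have h1 := (mdifferentiableAt_section 𝓘(ℝ, E) X).1 hX
  have hsrc : ∀ᶠ x in nhds x₀, x ∈ (chartAt E x₀).source :=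
    (chartAt E x₀).open_source.mem_nhds (mem_chart_source E x₀)
  have h2 : MDifferentiableAt 𝓘(ℝ, E) 𝓘(ℝ, E) (vectorFieldInChart x₀ X) x₀ := by
    refine h1.congr_of_eventuallyEq ?_
    filter_upwards [hsrc] with x hx
    have h4 := congrArg (fun L : E →L[ℝ] E => L (X x : E))
      (TangentBundle.continuousLinearMapAt_trivializationAt (I := 𝓘(ℝ, E)) hx)
    have h5 := congrFun (Bundle.Trivialization.coe_linearMapAt_of_mem (R := ℝ)
      (trivializationAt E (TangentSpace 𝓘(ℝ, E)) x₀) (b := x) (by simpa using hx)) (X x)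
    exact h4.symm.trans h5
  have h3 := h2.differentiableWithinAt_writtenInExtChartAt
  rw [modelWithCornersSelf_coe, Set.range_id, differentiableWithinAt_univ] at h3
  exact h3

/-- If the vector field `X` is annihilated by the differential of `f`, the derivative along `X` of
the push-forward of a `k`-vector field along `f` is the push-forward of its Lie derivative. -/
theorem mfderiv_pushforwardInChart_apply {f : M → N} (x₀ : M)
    (hf : ContMDiff 𝓘(ℝ, E) 𝓘(ℝ, F) ∞ f) {T : Π x : M, KVector k (TangentSpace 𝓘(ℝ, E) x)}
    (hT : IsSmoothKVectorField T) {X : Π x : M, TangentSpace 𝓘(ℝ, E) x}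
    (hX : MDifferentiableAt 𝓘(ℝ, E) 𝓘(ℝ, E).tangent
      (fun x => (⟨x, X x⟩ : TangentBundle 𝓘(ℝ, E) M)) x₀)
    (hfX : ∀ x, mfderiv 𝓘(ℝ, E) 𝓘(ℝ, F) f x (X x) = 0) :
    mfderiv 𝓘(ℝ, E) 𝓘(ℝ, KVector k F) (pushforwardInChart (F := F) (f x₀) f T) x₀ (X x₀) =
      KVector.map (mfderiv 𝓘(ℝ, E) 𝓘(ℝ, F) f x₀) (mkvectorLieDeriv X T x₀) := by
  have : IsManifold 𝓘(ℝ, E) 1 M := .of_le (n := ∞) (by simp)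
  set Φ := fun y => KVector.map (fderiv ℝ (writtenInPreferredCharts E F f x₀) y)
        ((kvectorFieldInChart x₀ T ∘ (extChartAt 𝓘(ℝ, E) x₀).symm) y) with hΦ
  set Y : E → E := vectorFieldInChart x₀ X ∘ (extChartAt 𝓘(ℝ, E) x₀).symm with hY
  have hYx : Y (extChartAt 𝓘(ℝ, E) x₀ x₀) = X x₀ := by
    have h : ∀ x, x = x₀ → vectorFieldInChart x₀ X x = (X x₀ : E) := by
      rintro x rfl
      exact congrArg (fun L : E →L[ℝ] E => L (X x : E)) mfderiv_extChartAt_self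
    exact h _ (extChartAt_to_inv x₀)
  have hΦd : DifferentiableAt ℝ Φ (extChartAt 𝓘(ℝ, E) x₀ x₀) :=
    (contDiffAt_map_fderiv_writtenInPreferredCharts (F := F) x₀ hf hT).differentiableAt (by simp)
  have e1 : mfderiv 𝓘(ℝ, E) 𝓘(ℝ, KVector k F) (pushforwardInChart (F := F) (f x₀) f T) x₀ =
      fderiv ℝ Φ (extChartAt 𝓘(ℝ, E) x₀ x₀) := by
    rw [(pushforwardInChart_eventuallyEq (F := F) x₀ hf T).mfderiv_eq,
      mfderiv_comp x₀ hΦd.mdifferentiableAt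
        (mdifferentiableAt_extChartAt (mem_chart_source E x₀)), mfderiv_extChartAt_self,
      mfderiv_eq_fderiv]
    rfl
  have hPY : ∀ᶠ y in nhds (extChartAt 𝓘(ℝ, E) x₀ x₀),
      fderiv ℝ (writtenInPreferredCharts E F f x₀) y (Y y) = 0 := by
    have h1 := eventually_mfderiv_extChartAt_comp_mfderiv x₀ hf
    have hc : Filter.Tendsto (extChartAt 𝓘(ℝ, E) x₀).symm (nhds (extChartAt 𝓘(ℝ, E) x₀ x₀))
        (nhds x₀) := by
      simpa [ContinuousAt] using continuousAt_extChartAt_symm (I := 𝓘(ℝ, E)) x₀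
    filter_upwards [hc.eventually h1, extChartAt_target_mem_nhds_self x₀] with y hy hyt
    rw [(extChartAt 𝓘(ℝ, E) x₀).right_inv hyt] at hy
    have h2 := congrArg
      (fun L : E →L[ℝ] F => L (X ((extChartAt 𝓘(ℝ, E) x₀).symm y) : E)) hy
    refine h2.symm.trans ?_
    change mfderiv 𝓘(ℝ, F) 𝓘(ℝ, F) (extChartAt 𝓘(ℝ, F) (f x₀)) _
      (mfderiv 𝓘(ℝ, E) 𝓘(ℝ, F) f _ (X _)) = 0
    rw [hfX]
    exact map_zero (mfderiv 𝓘(ℝ, F) 𝓘(ℝ, F) (extChartAt 𝓘(ℝ, F) (f x₀)) _)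
  have key := fderiv_map_fderiv_apply_eq_map_kvectorLieDeriv
    ((contDiffAt_writtenInPreferredCharts (hf.contMDiffAt (x := x₀))).of_le (WithTop.coe_le_coe.2 le_top))
    (differentiableAt_vectorFieldInChart_comp_extChartAt_symm hX)
    ((contDiffAt_comp_extChartAt_symm (hT x₀)).differentiableAt (by simp)) hPY
  -- The preferred chart has identity differential at its own base point, so the inverse in
  -- `mkvectorLieDeriv` disappears.
  let D : E →L[ℝ] E := mfderiv 𝓘(ℝ, E) 𝓘(ℝ, E) (extChartAt 𝓘(ℝ, E) x₀) x₀
  have hD : D = ContinuousLinearMap.id ℝ E := mfderiv_extChartAt_self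
  have e2 : ∀ S : KVector k E, KVector.map D.inverse S = S := by
    intro S
    rw [hD, ContinuousLinearMap.inverse_id, KVector.map_id]
  rw [e1, mfderiv_eq_fderiv_writtenInPreferredCharts (hf.mdifferentiableAt (by simp))]
  refine Eq.trans ?_ (congrArg (fun S : KVector k E =>
    KVector.map (fderiv ℝ (writtenInPreferredCharts E F f x₀) _) S) (e2 _)).symm
  refine Eq.trans ?_ key
  exact congrArg (fderiv ℝ Φ _) hYx.symm

end PushforwardInChart

/-! ### Vanishing derivative on a connected manifold. -/

section Connected

/-- A differentiable function with zero derivative on a connected manifold is constant. -/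
theorem eq_of_mfderiv_eq_zero {E : Type*} [NormedAddCommGroup E] [NormedSpace ℝ E]
    {M : Type*} [TopologicalSpace M] [ChartedSpace E M] [IsManifold 𝓘(ℝ, E) 1 M]
    [PreconnectedSpace M] {W : Type*} [NormedAddCommGroup W] [NormedSpace ℝ W] {f : M → W}
    (hf : MDifferentiable 𝓘(ℝ, E) 𝓘(ℝ, W) f) (hf' : ∀ x, mfderiv 𝓘(ℝ, E) 𝓘(ℝ, W) f x = 0)
    (x y : M) : f x = f y := by
  refine IsLocallyConstant.apply_eq_of_preconnectedSpace ?_ x y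
  rw [IsLocallyConstant.iff_eventually_eq]
  intro x₀
  set φ := extChartAt 𝓘(ℝ, E) x₀ with hφ
  obtain ⟨r, hr, hball⟩ := Metric.mem_nhds_iff.1 (extChartAt_target_mem_nhds_self (E := E) x₀)
  have hd : ∀ z ∈ Metric.ball (φ x₀) r, HasFDerivAt (f ∘ φ.symm) (0 : E →L[ℝ] W) z := by
    intro z hz
    have h1 : MDifferentiableAt 𝓘(ℝ, E) 𝓘(ℝ, E) φ.symm z := by
      have := mdifferentiableWithinAt_extChartAt_symm (I := 𝓘(ℝ, E)) (hball hz)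
      rwa [modelWithCornersSelf_coe, Set.range_id, mdifferentiableWithinAt_univ] at this
    have h2 := (hf (φ.symm z)).hasMFDerivAt.comp z h1.hasMFDerivAt
    rw [hf'] at h2
    have h3 := h2.hasFDerivAt
    have h4 : ((0 : E →L[ℝ] W).comp (mfderiv 𝓘(ℝ, E) 𝓘(ℝ, E) φ.symm z : E →L[ℝ] E)) = 0 :=
      ContinuousLinearMap.zero_comp _
    exact h4 ▸ h3
  have hconst : ∀ z ∈ Metric.ball (φ x₀) r, (f ∘ φ.symm) z = (f ∘ φ.symm) (φ x₀) := fun z hz =>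
    Metric.isOpen_ball.is_const_of_fderiv_eq_zero (𝕜 := ℝ)
      (convex_ball (φ x₀) r).isPreconnected
      (fun w hw => (hd w hw).differentiableAt.differentiableWithinAt)
      (fun w hw => (hd w hw).fderiv) hz (Metric.mem_ball_self hr)
  have hsrc : ∀ᶠ x in nhds x₀, x ∈ (chartAt E x₀).source :=
    (chartAt E x₀).open_source.mem_nhds (mem_chart_source E x₀)
  filter_upwards [(continuousAt_extChartAt (I := 𝓘(ℝ, E)) x₀).eventually
    (Metric.ball_mem_nhds _ hr), hsrc] with x hx hxs
  have h := hconst _ hx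
  simp only [Function.comp_apply] at h
  rwa [φ.left_inv (by rwa [hφ, extChartAt_source]), φ.left_inv (mem_extChartAt_source x₀)] at h

end Connected

/-! ### Local sections of submersions. -/

section Submersion

/-- A submersion has smooth local sections. -/
theorem Manifold.IsSubmersion.exists_contMDiffAt_section {n : WithTop ℕ∞}
    {E : Type*} [NormedAddCommGroup E] [NormedSpace ℝ E]
    {M : Type*} [TopologicalSpace M] [ChartedSpace E M]
    {F : Type*} [NormedAddCommGroup F] [NormedSpace ℝ F]
    {N : Type*} [TopologicalSpace N] [ChartedSpace F N]
    [IsManifold 𝓘(ℝ, E) n M] [IsManifold 𝓘(ℝ, F) n N] {f : M → N}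
    (hf : IsSubmersion 𝓘(ℝ, E) 𝓘(ℝ, F) n f) (x₀ : M) :
    ∃ σ : N → M, ContMDiffAt 𝓘(ℝ, F) 𝓘(ℝ, E) n σ (f x₀) ∧ σ (f x₀) = x₀ ∧
      ∀ᶠ y in nhds (f x₀), f (σ y) = y := by
  have h := hf.isSubmersionAt x₀
  set φ := h.domChart
  set ψ := h.codChart
  set e := h.equiv
  have hx := h.mem_domChart_source
  have hy := h.mem_codChart_source
  -- In adapted charts `f` is the first projection; the section freezes the second coordinate at its
  -- value at `x₀`.
  let c : F → E := fun v => e.symm (v, (e (φ x₀)).2)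
  have hc : ContDiff ℝ n c := e.symm.contDiff.comp (contDiff_id.prodMk contDiff_const)
  have hw : ∀ z ∈ φ.target, ψ (f (φ.symm z)) = (e z).1 := by
    intro z hz
    have hz' : z ∈ (φ.extend 𝓘(ℝ, E)).target := by simpa using hz
    simpa using h.writtenInCharts hz'
  have h0 : ψ (f x₀) = (e (φ x₀)).1 := by
    rw [← hw _ (φ.map_source hx), φ.left_inv hx]
  have hc0 : c (ψ (f x₀)) = φ x₀ := by simp [c, h0]
  have hψ : ContMDiffAt 𝓘(ℝ, F) 𝓘(ℝ, F) n ψ (f x₀) :=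
    contMDiffAt_of_mem_maximalAtlas h.codChart_mem_maximalAtlas hy
  have hcψ : ContMDiffAt 𝓘(ℝ, F) 𝓘(ℝ, E) n (c ∘ ψ) (f x₀) :=
    hc.contMDiff.contMDiffAt.comp _ hψ
  refine ⟨φ.symm ∘ (c ∘ ψ), ?_, ?_, ?_⟩
  · refine ContMDiffAt.comp _ ?_ hcψ
    refine contMDiffAt_symm_of_mem_maximalAtlas h.domChart_mem_maximalAtlas ?_
    rw [Function.comp_apply, hc0]
    exact φ.map_source hx
  · simp only [Function.comp_apply, hc0, φ.left_inv hx]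
  · have h1 : ∀ᶠ y in nhds (f x₀), (c ∘ ψ) y ∈ φ.target := by
      refine hcψ.continuousAt.preimage_mem_nhds (φ.open_target.mem_nhds ?_)
      rw [Function.comp_apply, hc0]
      exact φ.map_source hx
    filter_upwards [h1, ψ.open_source.mem_nhds hy] with y hyt hys
    refine ψ.injOn ?_ hys ?_
    · exact h.source_subset_preimage_source (φ.map_target hyt)
    · simp only [Function.comp_apply] at hyt ⊢
      rw [hw _ hyt]
      simp [c]

end Submersion

/-! ### Left-invariant fields and left cosets. -/

section LeftInvariant

variable {E : Type*} [NormedAddCommGroup E] [NormedSpace ℝ E]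
  {G : Type*} [TopologicalSpace G] [ChartedSpace E G] [Group G]

theorem IsLeftInvariantVectorField.eq_mulInvariantVectorField
    {X : Π g : G, TangentSpace 𝓘(ℝ, E) g} (hX : IsLeftInvariantVectorField X) :
    X = mulInvariantVectorField (X 1) := by
  funext g
  -- The fibres over `g * 1` and `g` are both `E`, so the change of base point is stated as an
  -- equality in `E`.
  have h : ∀ c : G, c = g → (X c : E) = (X g : E) := by rintro c rfl; rfl
  exact (h _ (mul_one g)).symm.trans (hX g 1).symm

variable [LieGroup 𝓘(ℝ, E) ∞ G]

theorem LieGroup.mdifferentiableAt_mul_left (a b : G) :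
    MDifferentiableAt 𝓘(ℝ, E) 𝓘(ℝ, E) (fun x : G => a * x) b :=
  (contMDiff_mul_left (I := 𝓘(ℝ, E)) (n := ∞) (a := a)).mdifferentiableAt (by simp)

theorem mfderiv_mul_left_mfderiv_mul_left (a b c : G) (v : TangentSpace 𝓘(ℝ, E) c) :
    mfderiv 𝓘(ℝ, E) 𝓘(ℝ, E) (fun x : G => a * x) (b * c)
      (mfderiv 𝓘(ℝ, E) 𝓘(ℝ, E) (fun x : G => b * x) c v) =
    mfderiv 𝓘(ℝ, E) 𝓘(ℝ, E) (fun x : G => a * b * x) c v := by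
  have h := mfderiv_comp_apply (I := 𝓘(ℝ, E)) (I' := 𝓘(ℝ, E)) (I'' := 𝓘(ℝ, E)) c
    (LieGroup.mdifferentiableAt_mul_left (E := E) a (b * c)) (LieGroup.mdifferentiableAt_mul_left (E := E) b c) v
  rw [← h]
  congr 2
  funext x
  simp [mul_assoc]

/-- Translating back by `a⁻¹` provides the preimage. Hence left-invariant fields take every tangent
vector as a value. -/
theorem exists_mfderiv_mul_left_one_eq (a : G) (w : E) :
    ∃ v : E, (mfderiv 𝓘(ℝ, E) 𝓘(ℝ, E) (fun x : G => a * x) 1 : E →L[ℝ] E) v = w := by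
  refine ⟨(mfderiv 𝓘(ℝ, E) 𝓘(ℝ, E) (fun x : G => a⁻¹ * x) a : E →L[ℝ] E) w, ?_⟩
  have h := mfderiv_mul_left_mfderiv_mul_left (E := E) a a⁻¹ a w
  have h1 : (fun x : G => a * a⁻¹ * x) = id := by funext x; simp
  rw [h1, mfderiv_id] at h
  have h2 : ∀ c : G, c = 1 → ∀ u : E,
      (mfderiv 𝓘(ℝ, E) 𝓘(ℝ, E) (fun x : G => a * x) 1 : E →L[ℝ] E) u =
      (mfderiv 𝓘(ℝ, E) 𝓘(ℝ, E) (fun x : G => a * x) c : E →L[ℝ] E) u := by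
    rintro c rfl u; rfl
  exact (h2 _ (inv_mul_cancel a) _).trans h

theorem isLeftInvariantVectorField_mulInvariantVectorField (u : GroupLieAlgebra 𝓘(ℝ, E) G) :
    IsLeftInvariantVectorField (mulInvariantVectorField u) := by
  intro a g
  have h := mfderiv_mul_left_mfderiv_mul_left (E := E) a g 1 u
  have h2 : ∀ c : G, c = g → ∀ v : E,
      (mfderiv 𝓘(ℝ, E) 𝓘(ℝ, E) (fun x : G => a * x) g : E →L[ℝ] E) v =
      (mfderiv 𝓘(ℝ, E) 𝓘(ℝ, E) (fun x : G => a * x) c : E →L[ℝ] E) v := by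
    rintro c rfl v; rfl
  exact (h2 _ (mul_one g) _).trans h

theorem IsLeftInvariantVectorField.mdifferentiableAt
    {X : Π g : G, TangentSpace 𝓘(ℝ, E) g} (hX : IsLeftInvariantVectorField X) (g : G) :
    MDifferentiableAt 𝓘(ℝ, E) 𝓘(ℝ, E).tangent
      (fun x => (⟨x, X x⟩ : TangentBundle 𝓘(ℝ, E) G)) g := by
  have : LieGroup 𝓘(ℝ, E) (minSmoothness ℝ 3) G := by
    rw [minSmoothness_of_isRCLikeNormedField]
    exact .of_le (n := ∞) (WithTop.coe_le_coe.2 le_top)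
  rw [hX.eq_mulInvariantVectorField]
  exact mdifferentiableAt_mulInvariantVectorField _

variable {E' : Type*} [NormedAddCommGroup E'] [NormedSpace ℝ E']
  {H : Type*} [TopologicalSpace H] [ChartedSpace E' H] [Group H]
  {ι : H →* G}

theorem mfderiv_mul_left_mfderiv_hom (hι : ContMDiff 𝓘(ℝ, E') 𝓘(ℝ, E) ∞ ι)
    (g : G) (p : H) (w : TangentSpace 𝓘(ℝ, E') p) :
    mfderiv 𝓘(ℝ, E) 𝓘(ℝ, E) (fun x : G => g * x) (ι p) (mfderiv 𝓘(ℝ, E') 𝓘(ℝ, E) ι p w) =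
      mfderiv 𝓘(ℝ, E') 𝓘(ℝ, E) (fun q => g * ι q) p w :=
  (mfderiv_comp_apply (I := 𝓘(ℝ, E')) (I' := 𝓘(ℝ, E)) (I'' := 𝓘(ℝ, E)) p
    (LieGroup.mdifferentiableAt_mul_left (E := E) g (ι p)) (hι.mdifferentiableAt (by simp)) w).symm

variable {F : Type*} [NormedAddCommGroup F] [NormedSpace ℝ F] [ChartedSpace F (G ⧸ ι.range)]

/-- A left-invariant vector field tangent to a Lie subgroup is tangent to its left cosets. -/
theorem mfderiv_quotientMk_apply_eq_zero (hι : ContMDiff 𝓘(ℝ, E') 𝓘(ℝ, E) ∞ ι)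
    (hπ : ContMDiff 𝓘(ℝ, E) 𝓘(ℝ, F) ∞ (QuotientGroup.mk : G → G ⧸ ι.range))
    {X : Π g : G, TangentSpace 𝓘(ℝ, E) g} (hX : IsLeftInvariantVectorField X)
    (hX' : IsTangentTo E' ι X) (g : G) :
    mfderiv 𝓘(ℝ, E) 𝓘(ℝ, F) (QuotientGroup.mk : G → G ⧸ ι.range) g (X g) = 0 := by
  -- Writing `g` as `g * ι 1` makes `X g` the translate of `X (ι 1)`, the only point where tangency
  -- is used.
  have hg : g * ι 1 = g := by simp
  rw [← hg]
  obtain ⟨w, hw⟩ := hX' 1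
  rw [← hX g (ι 1), ← hw, mfderiv_mul_left_mfderiv_hom hι]
  have h := mfderiv_comp_apply (I := 𝓘(ℝ, E')) (I' := 𝓘(ℝ, E)) (I'' := 𝓘(ℝ, F)) (1 : H)
    (g := (QuotientGroup.mk : G → G ⧸ ι.range)) (f := fun q : H => g * ι q)
    (hπ.mdifferentiableAt (by simp)) ((LieGroup.mdifferentiableAt_mul_left (E := E) g _).comp (1 : H)
      (hι.mdifferentiableAt (by simp))) w
  rw [← h]
  -- The map `q ↦ g * ι q` stays in one coset, so its composite with the projection is constant.
  have h1 : ((QuotientGroup.mk : G → G ⧸ ι.range) ∘ fun q : H => g * ι q) =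
      fun _ => (QuotientGroup.mk g : G ⧸ ι.range) := by
    funext q
    exact QuotientGroup.mk_mul_of_mem g ⟨q, rfl⟩
  rw [h1, mfderiv_const]
  rfl

/-- The left-invariant vector field on `G` generated by a tangent vector to a Lie subgroup at the
identity restricts to the left-invariant field on the subgroup. -/
theorem mfderiv_hom_mfderiv_mul_left_one [LieGroup 𝓘(ℝ, E') ∞ H]
    (hι : ContMDiff 𝓘(ℝ, E') 𝓘(ℝ, E) ∞ ι)
    (p : H) (w : E') :
    (mfderiv 𝓘(ℝ, E') 𝓘(ℝ, E) ι p : E' →L[ℝ] E)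
      ((mfderiv 𝓘(ℝ, E') 𝓘(ℝ, E') (fun q : H => p * q) 1 : E' →L[ℝ] E') w) =
    (mulInvariantVectorField (I := 𝓘(ℝ, E)) (G := G)
      ((mfderiv 𝓘(ℝ, E') 𝓘(ℝ, E) ι 1 : E' →L[ℝ] E) w) (ι p) : E) := by
  have h1 := mfderiv_mul_left_mfderiv_hom hι (ι p) 1 w
  have h2 := mfderiv_comp_apply (I := 𝓘(ℝ, E')) (I' := 𝓘(ℝ, E')) (I'' := 𝓘(ℝ, E)) (1 : H)
    (g := ι) (f := fun q : H => p * q)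
    (hι.mdifferentiableAt (by simp)) (LieGroup.mdifferentiableAt_mul_left (E := E') p 1) w
  have h3 : (ι ∘ fun q : H => p * q) = fun q => ι p * ι q := by funext q; simp
  rw [h3] at h2
  have h4 : ∀ c : H, c = p → ∀ v : E', (mfderiv 𝓘(ℝ, E') 𝓘(ℝ, E) ι p : E' →L[ℝ] E) v =
      (mfderiv 𝓘(ℝ, E') 𝓘(ℝ, E) ι c : E' →L[ℝ] E) v := by rintro c rfl v; rfl
  have h5 : ∀ c : G, c = 1 → ∀ v : E,
      (mfderiv 𝓘(ℝ, E) 𝓘(ℝ, E) (fun x : G => ι p * x) c : E →L[ℝ] E) v =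
      (mfderiv 𝓘(ℝ, E) 𝓘(ℝ, E) (fun x : G => ι p * x) 1 : E →L[ℝ] E) v := by
    rintro c rfl v; rfl
  exact (h4 _ (mul_one p) _).trans (h2.symm.trans (h1.symm.trans (h5 _ (map_one ι) _)))

end LeftInvariant

/-! ### Projection to the quotient. -/

section Quotient

variable {k : ℕ} {E : Type*} [NormedAddCommGroup E] [NormedSpace ℝ E]
  {G : Type*} [TopologicalSpace G] [ChartedSpace E G]
  {F : Type*} [NormedAddCommGroup F] [NormedSpace ℝ F]

/-- If `S` is `f`-related to `T`, pushing `T` forward amounts to evaluating `S`. -/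
theorem pushforwardInChart_eq_kvectorFieldInChart {N : Type*} [TopologicalSpace N]
    [ChartedSpace F N] {f : G → N} {T : Π x : G, KVector k (TangentSpace 𝓘(ℝ, E) x)}
    {S : Π y : N, KVector k (TangentSpace 𝓘(ℝ, F) y)}
    (h : ∀ x, KVector.map (mfderiv 𝓘(ℝ, E) 𝓘(ℝ, F) f x) (T x) = S (f x)) (y₀ : N) :
    pushforwardInChart y₀ f T = kvectorFieldInChart y₀ S ∘ f := by
  funext x
  simp only [pushforwardInChart, kvectorFieldInChart, Function.comp_apply, h x]

theorem pushforwardInChart_self {N : Type*} [TopologicalSpace N]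
    [ChartedSpace F N] [IsManifold 𝓘(ℝ, F) ∞ N] (f : G → N)
    (T : Π x : G, KVector k (TangentSpace 𝓘(ℝ, E) x)) (x : G) :
    pushforwardInChart (F := F) (f x) f T x =
      KVector.map (mfderiv 𝓘(ℝ, E) 𝓘(ℝ, F) f x) (T x) := by
  have : IsManifold 𝓘(ℝ, F) 1 N := .of_le (n := ∞) (by simp)
  have h : (mfderiv 𝓘(ℝ, F) 𝓘(ℝ, F) (extChartAt 𝓘(ℝ, F) (f x)) (f x) : F →L[ℝ] F) =
    ContinuousLinearMap.id ℝ F := mfderiv_extChartAt_self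
  exact congrArg (fun A : F →L[ℝ] F => KVector.map A
    (KVector.map (V := E) (W := F) (mfderiv 𝓘(ℝ, E) 𝓘(ℝ, F) f x) (T x))) h

variable [Group G] [LieGroup 𝓘(ℝ, E) ∞ G]
  {E' : Type*} [NormedAddCommGroup E'] [NormedSpace ℝ E']
  {H : Type*} [TopologicalSpace H] [ChartedSpace E' H] [Group H]
  {ι : H →* G} [ChartedSpace F (G ⧸ ι.range)] [IsManifold 𝓘(ℝ, F) ∞ (G ⧸ ι.range)]
  {V : Π g : G, KVector k (TangentSpace 𝓘(ℝ, E) g)}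

/-- A projectable `k`-vector field has vertical Lie derivatives along the left-invariant vector
fields tangent to the subgroup. -/
theorem Projects.map_mkvectorLieDeriv_eq_zero
    (hι : ContMDiff 𝓘(ℝ, E') 𝓘(ℝ, E) ∞ ι)
    (hπ : ContMDiff 𝓘(ℝ, E) 𝓘(ℝ, F) ∞ (QuotientGroup.mk : G → G ⧸ ι.range))
    (hV : IsSmoothKVectorField V)
    (h : Projects F (QuotientGroup.mk : G → G ⧸ ι.range) V)
    {X : Π g : G, TangentSpace 𝓘(ℝ, E) g} (hX : IsLeftInvariantVectorField X)
    (hX' : IsTangentTo E' ι X) (g : G) :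
    KVector.map (mfderiv 𝓘(ℝ, E) 𝓘(ℝ, F) (QuotientGroup.mk : G → G ⧸ ι.range) g)
      (mkvectorLieDeriv X V g) = 0 := by
  obtain ⟨S, hS, hSV⟩ := h
  have hπX := mfderiv_quotientMk_apply_eq_zero hι hπ hX hX'
  rw [← mfderiv_pushforwardInChart_apply (F := F) g hπ hV (hX.mdifferentiableAt g) hπX,
    pushforwardInChart_eq_kvectorFieldInChart hSV]
  have h1 := mfderiv_comp_apply (I := 𝓘(ℝ, E)) (I' := 𝓘(ℝ, F)) (I'' := 𝓘(ℝ, KVector k F)) g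
    (g := kvectorFieldInChart (g : G ⧸ ι.range) S) (f := (QuotientGroup.mk : G → G ⧸ ι.range))
    ((hS _).mdifferentiableAt (by simp)) (hπ.mdifferentiableAt (by simp)) (X g)
  rw [h1, hπX]
  exact map_zero (mfderiv 𝓘(ℝ, F) 𝓘(ℝ, KVector k F) (kvectorFieldInChart (g : G ⧸ ι.range) S) _)

variable [LieGroup 𝓘(ℝ, E') ∞ H] [ConnectedSpace H]

/-- If the Lie derivatives along the left-invariant vector fields tangent to a connected Lie
subgroup are vertical, the push-forward to the quotient is constant along left cosets. -/
theorem pushforwardInChart_quotientMk_mul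
    (hι : ContMDiff 𝓘(ℝ, E') 𝓘(ℝ, E) ∞ ι)
    (hπ : ContMDiff 𝓘(ℝ, E) 𝓘(ℝ, F) ∞ (QuotientGroup.mk : G → G ⧸ ι.range))
    (hV : IsSmoothKVectorField V)
    (hLie : ∀ X : Π g : G, TangentSpace 𝓘(ℝ, E) g,
      IsLeftInvariantVectorField X → IsTangentTo E' ι X → ∀ g : G,
        KVector.map (mfderiv 𝓘(ℝ, E) 𝓘(ℝ, F) (QuotientGroup.mk : G → G ⧸ ι.range) g)
          (mkvectorLieDeriv X V g) = 0) (g : G) (p q : H) :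
    pushforwardInChart (F := F) (g : G ⧸ ι.range) QuotientGroup.mk V (g * ι p) =
      pushforwardInChart (F := F) (g : G ⧸ ι.range) QuotientGroup.mk V (g * ι q) := by
  have : IsManifold 𝓘(ℝ, E') 1 H := .of_le (n := ∞) (by simp)
  set Ψ : G → KVector k F :=
    pushforwardInChart (F := F) (g : G ⧸ ι.range) QuotientGroup.mk V with hΨ
  -- All points of the coset share one image, hence one preferred chart, so the key identity applies
  -- to the same `Ψ` at each of them.
  have hmk : ∀ p : H, (QuotientGroup.mk (g * ι p) : G ⧸ ι.range) = QuotientGroup.mk g :=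
    fun p => QuotientGroup.mk_mul_of_mem g ⟨p, rfl⟩
  have hΨd : ∀ p : H, MDifferentiableAt 𝓘(ℝ, E) 𝓘(ℝ, KVector k F) Ψ (g * ι p) := fun p => by
    have h := contMDiffAt_pushforwardInChart (F := F) (g * ι p) hπ hV
    rw [hmk] at h
    exact h.mdifferentiableAt (by simp)
  have hgι : MDifferentiable 𝓘(ℝ, E') 𝓘(ℝ, E) (fun p : H => g * ι p) := fun p =>
    (LieGroup.mdifferentiableAt_mul_left (E := E) g _).comp p (hι.mdifferentiableAt (by simp))
  refine eq_of_mfderiv_eq_zero (E := E') (f := fun p : H => Ψ (g * ι p))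
    (fun p => (hΨd p).comp p (hgι p)) (fun p => ?_) p q
  ext1 w
  -- `w'` is `w` carried back to the identity of `H`; the left-invariant field generated by its
  -- image under `dι` then has at `g * ι p` the image of `w`.
  obtain ⟨w', hw'⟩ := exists_mfderiv_mul_left_one_eq (E := E') p w
  set X := mulInvariantVectorField (I := 𝓘(ℝ, E)) (G := G)
    ((mfderiv 𝓘(ℝ, E') 𝓘(ℝ, E) ι 1 : E' →L[ℝ] E) w') with hXdef
  have hX : IsLeftInvariantVectorField X := isLeftInvariantVectorField_mulInvariantVectorField _
  have hXι : IsTangentTo E' ι X := fun p => ⟨_, mfderiv_hom_mfderiv_mul_left_one hι p w'⟩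
  have h1 := mfderiv_pushforwardInChart_apply (F := F) (g * ι p) hπ hV
    (hX.mdifferentiableAt _) (mfderiv_quotientMk_apply_eq_zero hι hπ hX hXι)
  rw [hLie X hX hXι, hmk] at h1
  have h2 : (mfderiv 𝓘(ℝ, E') 𝓘(ℝ, E) (fun p : H => g * ι p) p : E' →L[ℝ] E) w =
      X (g * ι p) := by
    have h3 := mfderiv_hom_mfderiv_mul_left_one hι p w'
    rw [hw'] at h3
    rw [← hX g (ι p)]
    refine (mfderiv_mul_left_mfderiv_hom hι g p w).symm.trans ?_
    exact congrArg (mfderiv 𝓘(ℝ, E) 𝓘(ℝ, E) (fun b : G => g * b) (ι p)) h3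
  have h4 := mfderiv_comp_apply (I := 𝓘(ℝ, E')) (I' := 𝓘(ℝ, E)) (I'' := 𝓘(ℝ, KVector k F)) p
    (g := Ψ) (f := fun p : H => g * ι p) (hΨd p) (hgι p) w
  refine h4.trans ?_
  exact (congrArg (mfderiv 𝓘(ℝ, E) 𝓘(ℝ, KVector k F) Ψ (g * ι p)) h2).trans h1

/-- The projected field is read off at a chosen coset representative, and constancy along cosets
makes the choice irrelevant. It is smooth because, with a local section `σ`, its chart expression is
locally the push-forward function composed with `σ`. -/
theorem projects_of_map_mkvectorLieDeriv_eq_zero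
    (hι : ContMDiff 𝓘(ℝ, E') 𝓘(ℝ, E) ∞ ι)
    (hπ : Manifold.IsSubmersion 𝓘(ℝ, E) 𝓘(ℝ, F) ∞ (QuotientGroup.mk : G → G ⧸ ι.range))
    (hV : IsSmoothKVectorField V)
    (hLie : ∀ X : Π g : G, TangentSpace 𝓘(ℝ, E) g,
      IsLeftInvariantVectorField X → IsTangentTo E' ι X → ∀ g : G,
        KVector.map (mfderiv 𝓘(ℝ, E) 𝓘(ℝ, F) (QuotientGroup.mk : G → G ⧸ ι.range) g)
          (mkvectorLieDeriv X V g) = 0) :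
    Projects F (QuotientGroup.mk : G → G ⧸ ι.range) V := by
  have hS : ∀ g : G, KVector.map (mfderiv 𝓘(ℝ, E) 𝓘(ℝ, F)
      (QuotientGroup.mk : G → G ⧸ ι.range) g) (V g) =
      pushforwardInChart (F := F) (g : G ⧸ ι.range) QuotientGroup.mk V
        (g : G ⧸ ι.range).out := by
    intro g
    -- The chosen representative is `g * ι p` for some `p`; constancy compares it with `g = g * ι
    -- 1`.
    obtain ⟨⟨_, p, rfl⟩, hp⟩ := QuotientGroup.mk_out_eq_mul ι.range g
    have h := pushforwardInChart_quotientMk_mul (F := F) hι hπ.contMDiff hV hLie g 1 p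
    rw [map_one, mul_one] at h
    rw [hp]
    exact (pushforwardInChart_self (F := F) _ V g).symm.trans h
  let S : Π y : G ⧸ ι.range, KVector k (TangentSpace 𝓘(ℝ, F) y) :=
    fun y => pushforwardInChart (F := F) y QuotientGroup.mk V y.out
  have hSV : ∀ g : G, KVector.map (mfderiv 𝓘(ℝ, E) 𝓘(ℝ, F)
      (QuotientGroup.mk : G → G ⧸ ι.range) g) (V g) = S g := hS
  refine ⟨S, fun y₀ => ?_, hSV⟩
  obtain ⟨g, rfl⟩ := QuotientGroup.mk_surjective y₀
  obtain ⟨σ, hσ, hσg, hπσ⟩ := hπ.exists_contMDiffAt_section g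
  have h1 := contMDiffAt_pushforwardInChart (F := F) g hπ.contMDiff hV
  rw [pushforwardInChart_eq_kvectorFieldInChart hSV] at h1
  rw [← hσg] at h1
  have h2 := h1.comp _ hσ
  rw [hσg] at h2
  refine h2.congr_of_eventuallyEq ?_
  filter_upwards [hπσ] with y hy
  simp only [Function.comp_apply]
  rw [hy]

end Quotient

theorem lemma2
    {E : Type*} [NormedAddCommGroup E] [NormedSpace ℝ E] [FiniteDimensional ℝ E]
    {G : Type*} [TopologicalSpace G] [ChartedSpace E G] [Group G] [LieGroup 𝓘(ℝ, E) ∞ G]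
    -- the connected Lie subgroup: a connected Lie group `H`, injectively immersed in `G` by `ι`
    {E' : Type*} [NormedAddCommGroup E'] [NormedSpace ℝ E'] [FiniteDimensional ℝ E']
    {H : Type*} [TopologicalSpace H] [ChartedSpace E' H] [Group H] [LieGroup 𝓘(ℝ, E') ∞ H]
    [ConnectedSpace H]
    (ι : H →* G) (hι : Function.Injective ι)
    (hι' : Manifold.IsImmersion 𝓘(ℝ, E') 𝓘(ℝ, E) ∞ ι)
    -- the quotient manifold of left cosets: the smooth structure for which the canonical
    -- projection is a submersion
    {F : Type*} [NormedAddCommGroup F] [NormedSpace ℝ F] [FiniteDimensional ℝ F]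
    [ChartedSpace F (G ⧸ ι.range)] [IsManifold 𝓘(ℝ, F) ∞ (G ⧸ ι.range)]
    (hπ : Manifold.IsSubmersion 𝓘(ℝ, E) 𝓘(ℝ, F) ∞ (QuotientGroup.mk : G → G ⧸ ι.range))
    {k : ℕ} (V : Π g : G, KVector k (TangentSpace 𝓘(ℝ, E) g)) (hV : IsSmoothKVectorField V) :
    Projects F (QuotientGroup.mk : G → G ⧸ ι.range) V ↔
      ∀ X : Π g : G, TangentSpace 𝓘(ℝ, E) g,
        IsLeftInvariantVectorField X → IsTangentTo E' ι X →
          ∀ g : G, KVector.map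
            (mfderiv 𝓘(ℝ, E) 𝓘(ℝ, F) (QuotientGroup.mk : G → G ⧸ ι.range) g)
            (mkvectorLieDeriv X V g) = 0 := by
  refine ⟨fun h X hX hX' g => ?_, fun h => ?_⟩
  · exact h.map_mkvectorLieDeriv_eq_zero hι'.contMDiff hπ.contMDiff hV hX hX' g
  · exact projects_of_map_mkvectorLieDeriv_eq_zero hι'.contMDiff hπ hV h
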